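/- **Theorem 4.2 (Effective Glivenko theorem).** Conventions. A recursive function is a total recursive function with values in $\mathbb N$. A (multiple) sequence $\{r_i\}$ of rationals is recursive if $r_i=(-1)^{s(i)}a(i)/b(i)$ with recursive $s,a,b$ and $b(i)\neq0$. A (multiple) sequence $\{x_i\}$ of reals is computable if there is a recursive sequence of rationals $\{r_{i,k}\}$ with $|r_{i,k}-x_i|\le 2^{-k}$ for all $i,k$; a (multiple) sequence $\{z_i\}$ of complex numbers is computable if there are recursive sequences of rationals $\{r_{i,k}\}$, $\{s_{i,k}\}$ with $|r_{i,k}+\sqrt{-1}\,s_{i,k}-z_i|\le 2^{-k}$ for all $i,k$. A sequence $\{f_n\}$ of real- or complex-valued functions on $\mathbb R$ is computable if (i) the double sequence $\{f_n(x_m)\}$ is computable for every computable sequence $\{x_m\}$ of reals, and (ii) there is a recursive function $\alpha(n,L,k)$ such that $|x|,|y|\le L$ and $|x-y|<2^{-\alpha(n,L,k)}$ imply $|f_n(x)-f_n(y)|<2^{-k}$. A sequence $\{f_n\}$ of real-valued functions has compact support if there is a recursive function $L(n)$ with $f_n(x)=0$ whenever $|x|\ge L(n)$. The characteristic function of a probability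 distribution $\mu$ on $\mathbb R$ is $\varphi(t)=\int_{\mathbb R}e^{\sqrt{-1}\,tx}\,\mu(dx)$. Let $\{\mu_m\}$ be a sequence of probability distributions on $\mathbb R$ with characteristic functions $\{\varphi_m\}$, and let $\mu$ be a probability distribution on $\mathbb R$ with characteristic function $\varphi$. Suppose that $\{\varphi_m\}$ is a computable sequence of functions and that $\{\varphi_m\}$ converges effectively to $\varphi$, i.e. there is a recursive function $\beta(L,k)$ such that $m\ge\beta(L,k)$ and $|t|\le L$ imply $|\varphi_m(t)-\varphi(t)|<2^{-k}$. Then $\{\mu_m\}$ converges effectively to $\mu$: for every computable sequence $\{f_n\}$ of real-valued functions on $\mathbb R$ with compact support there is a recursive function $\gamma(n,k)$ such that $$\Bigl|\int_{\mathbb R} f_n\,d\mu_m-\int_{\mathbb R} f_n\,d\mu\Bigr|<2^{-k}\quad\text{for all } n,k\in\mathbb N \text{ and all } m\ge\gamma(n,k).$$ -/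

import Mathlib

open MeasureTheory

/-- A family of rational numbers indexed by `ι` (a set with a standard coding by natural numbers,
such as `ℕ`, `ℕ × ℕ` or `ℕ × ℕ × ℕ`) is recursive if it has the form `(-1) ^ s i * a i / b i`
with `s, a, b` (total) recursive functions and `b i ≠ 0`. -/
def IsRecursiveRat {ι : Type} [Primcodable ι] (r : ι → ℚ) : Prop :=
  ∃ s a b : ι → ℕ, Computable s ∧ Computable a ∧ Computable b ∧
    ∀ i, b i ≠ 0 ∧ r i = (-1) ^ s i * ((a i : ℚ) / (b i : ℚ))

/-- A (multiple) sequence of real numbers is computable if it is approximated by a recursive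
(multiple) sequence of rationals, the `k`-th approximation having error at most `2⁻ᵏ`. -/
def IsComputableReal {ι : Type} [Primcodable ι] (x : ι → ℝ) : Prop :=
  ∃ r : ι × ℕ → ℚ, IsRecursiveRat r ∧
    ∀ i k, |(r (i, k) : ℝ) - x i| ≤ ((2 : ℝ) ^ k)⁻¹

/-- A (multiple) sequence of complex numbers is computable if it is approximated by a recursive
(multiple) sequence of complex numbers with rational real and imaginary parts, the `k`-th
approximation having error at most `2⁻ᵏ`. -/
def IsComputableComplex {ι : Type} [Primcodable ι] (z : ι → ℂ) : Prop :=
  ∃ r s : ι × ℕ → ℚ, IsRecursiveRat r ∧ IsRecursiveRat s ∧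
    ∀ i k, ‖((r (i, k) : ℂ) + (s (i, k) : ℂ) * Complex.I) - z i‖ ≤ ((2 : ℝ) ^ k)⁻¹

/-- Effective continuity of a sequence of functions on `ℝ`: there is a recursive `α(n, L, k)` such
that `|x|, |y| ≤ L` and `|x - y| < 2 ^ (-α(n, L, k))` imply `‖f n x - f n y‖ < 2 ^ (-k)`. -/
def EffectivelyContinuous {E : Type} [NormedAddCommGroup E] (f : ℕ → ℝ → E) : Prop :=
  ∃ α : ℕ × ℕ × ℕ → ℕ, Computable α ∧
    ∀ n L k : ℕ, ∀ x y : ℝ, |x| ≤ L → |y| ≤ L → |x - y| < ((2 : ℝ) ^ α (n, L, k))⁻¹ →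
      ‖f n x - f n y‖ < ((2 : ℝ) ^ k)⁻¹

/-- A computable sequence of real-valued functions on `ℝ`: it maps computable sequences of reals
to computable double sequences of reals, and it is effectively continuous. -/
def IsComputableRealFun (f : ℕ → ℝ → ℝ) : Prop :=
  (∀ x : ℕ → ℝ, IsComputableReal x → IsComputableReal fun p : ℕ × ℕ => f p.1 (x p.2)) ∧
    EffectivelyContinuous f

/-- A computable sequence of complex-valued functions on `ℝ`: it maps computable sequences of
reals to computable double sequences of complex numbers, and it is effectively continuous. -/
def IsComputableComplexFun (f : ℕ → ℝ → ℂ) : Prop :=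
  (∀ x : ℕ → ℝ, IsComputableReal x → IsComputableComplex fun p : ℕ × ℕ => f p.1 (x p.2)) ∧
    EffectivelyContinuous f

/-- A sequence of functions on `ℝ` has (effectively) compact support if there is a recursive
function `L` such that `f n x = 0` whenever `|x| ≥ L n`. -/
def HasEffectiveCompactSupport (f : ℕ → ℝ → ℝ) : Prop :=
  ∃ L : ℕ → ℕ, Computable L ∧ ∀ n : ℕ, ∀ x : ℝ, (L n : ℝ) ≤ |x| → f n x = 0

/-- A sequence `f m` of complex-valued functions on `ℝ` converges effectively to `g` if there is a
recursive `α(L, k)` such that `m ≥ α(L, k)` and `|x| ≤ L` imply `|f m x - g x| < 2 ^ (-k)`. -/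
def ConvergesEffectively (f : ℕ → ℝ → ℂ) (g : ℝ → ℂ) : Prop :=
  ∃ α : ℕ × ℕ → ℕ, Computable α ∧
    ∀ L k m : ℕ, α (L, k) ≤ m → ∀ x : ℝ, |x| ≤ L → ‖f m x - g x‖ < ((2 : ℝ) ^ k)⁻¹

/-- A sequence `μ m` of probability distributions converges effectively to `ν` if, for every
computable sequence of functions `f n` with compact support, there is a recursive `α(n, k)` such
that `m ≥ α(n, k)` implies `|μ m (f n) - ν (f n)| < 2 ^ (-k)`. -/
def MeasuresConvergeEffectively (μ : ℕ → Measure ℝ) (ν : Measure ℝ) : Prop :=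
  ∀ f : ℕ → ℝ → ℝ, IsComputableRealFun f → HasEffectiveCompactSupport f →
    ∃ α : ℕ × ℕ → ℕ, Computable α ∧
      ∀ n k m : ℕ, α (n, k) ≤ m →
        |(∫ x, f n x ∂(μ m)) - ∫ x, f n x ∂ν| < ((2 : ℝ) ^ k)⁻¹

/-! Convolve both measures with a centred Gaussian of small variance `v`. For a bounded uniformly
continuous `f` this changes the integral by at most the oscillation of `f` at scale `δ` plus a
Chebyshev tail (`abs_integral_sub_integral_gaussianReal_le`). The smoothed measures have densities
that are Fourier integrals of the characteristic functions against a Gaussian weight of variance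
`v⁻¹`, so closeness of the characteristic functions on a long interval makes the densities uniformly
close (`abs_gaussianSmoothing_sub_le`). Integrating over the compact support gives the explicit
bound `abs_integral_sub_integral_le`.

The bound is effective because all its parameters, including a sup bound for `f`, are recursive in
the support radius and the modulus of continuity. -/

/-! ### Gaussian smoothing and Fourier estimates -/

open ProbabilityTheory in
/-- A function bounded by `B` everywhere and by `A` on `(-δ, δ)` has, against a centred Gaussian of
variance `v`, an integral of norm at most `A + B * v / δ ^ 2`. -/
theorem norm_integral_gaussianReal_le {E : Type*} [NormedAddCommGroup E] [NormedSpace ℝ E]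
    (v : NNReal) (g : ℝ → E) {A B δ : ℝ} (hA : 0 ≤ A) (hB : 0 ≤ B) (hδ : 0 < δ)
    (hgA : ∀ y, |y| < δ → ‖g y‖ ≤ A) (hgB : ∀ y, ‖g y‖ ≤ B) :
    ‖∫ y, g y ∂(gaussianReal 0 v)‖ ≤ A + B * v / δ ^ 2 := by
  have hsq : Integrable (fun y : ℝ => y ^ 2) (gaussianReal 0 v) :=
    (memLp_id_gaussianReal (μ := 0) (v := v) 2).integrable_sq
  have hvar : ∫ y, y ^ 2 ∂(gaussianReal 0 v) = (v : ℝ) := by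
    have h := variance_fun_id_gaussianReal (μ := 0) (v := v)
    rw [variance_eq_integral measurable_id'.aemeasurable] at h
    simpa [integral_id_gaussianReal] using h
  -- Chebyshev majorant: `1 ≤ y ^ 2 / δ ^ 2` off `(-δ, δ)`.
  have hint : Integrable (fun y : ℝ => A + B / δ ^ 2 * y ^ 2) (gaussianReal 0 v) :=
    (integrable_const _).add (hsq.const_mul _)
  refine (norm_integral_le_of_norm_le hint (Filter.Eventually.of_forall fun y => ?_)).trans_eq ?_
  · rcases lt_or_ge |y| δ with h | h
    · exact (hgA y h).trans (le_add_of_nonneg_right (by positivity))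
    · have h1 : δ ^ 2 ≤ y ^ 2 := by
        rw [← sq_abs y]; gcongr
      have h2 : B ≤ B / δ ^ 2 * y ^ 2 := by
        rw [div_mul_eq_mul_div, le_div_iff₀ (by positivity)]
        gcongr
      linarith [hgB y]
  · rw [integral_add (integrable_const _) (hsq.const_mul _), integral_const_mul, hvar]
    simp only [integral_const, probReal_univ, one_smul]
    ring

open ProbabilityTheory in
/-- The density at `y` of the convolution of `μ` with a centred Gaussian of variance `v`. -/
noncomputable def gaussianSmoothing (v : NNReal) (μ : Measure ℝ) (y : ℝ) : ℝ :=
  ∫ x, gaussianPDFReal 0 v (y - x) ∂μ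

open ProbabilityTheory in
theorem gaussianPDFReal_zero_le (v : NNReal) (x : ℝ) :
    gaussianPDFReal 0 v x ≤ (√(2 * Real.pi * v))⁻¹ := by
  rw [gaussianPDFReal]
  refine mul_le_of_le_one_right (by positivity) (Real.exp_le_one_iff.2 ?_)
  exact div_nonpos_of_nonpos_of_nonneg (by nlinarith [sq_nonneg (x - 0)]) (by positivity)

-- Up to normalisation the Gaussian is its own Fourier transform, with the variance inverted; this
-- brings characteristic functions into the smoothed density.
open ProbabilityTheory in
theorem ofReal_gaussianPDFReal_zero_sub (v : NNReal) (hv : v ≠ 0) (x y : ℝ) :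
    ((gaussianPDFReal 0 v (y - x) : ℝ) : ℂ) =
      ((√(2 * Real.pi * v))⁻¹ : ℝ) * charFun (gaussianReal 0 v⁻¹) (x - y) := by
  have hv' : (v : ℂ) ≠ 0 := by exact_mod_cast hv
  rw [charFun_gaussianReal, gaussianPDFReal, Complex.ofReal_mul, Complex.ofReal_exp]
  congr 2
  push_cast
  field_simp
  ring

open ProbabilityTheory in
/-- Fourier representation of the smoothed density. -/
theorem ofReal_gaussianSmoothing (v : NNReal) (hv : v ≠ 0) (μ : Measure ℝ)
    [IsProbabilityMeasure μ] (y : ℝ) :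
    (gaussianSmoothing v μ y : ℂ) = ((√(2 * Real.pi * v))⁻¹ : ℝ) *
      ∫ t, Complex.exp (-(t * y * Complex.I)) * charFun μ t ∂(gaussianReal 0 v⁻¹) := by
  rw [gaussianSmoothing, ← integral_complex_ofReal]
  simp_rw [ofReal_gaussianPDFReal_zero_sub v hv, integral_const_mul, charFun_apply_real]
  congr 1
  -- Fubini applies since the integrand is unimodular and both measures are finite.
  rw [integral_integral_swap]
  · congr 1 with t
    rw [← integral_const_mul]
    congr 1 with x
    rw [← Complex.exp_add]
    congr 1
    push_cast
    ring
  · refine Integrable.of_bound (C := 1) (Continuous.aestronglyMeasurable ?_)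
      (Filter.Eventually.of_forall fun p => ?_)
    · simp only [Function.uncurry_def]
      fun_prop
    · have h := Complex.norm_exp_ofReal_mul_I ((p.1 - y) * p.2)
      push_cast at h
      simpa [Function.uncurry_def] using h.le

open ProbabilityTheory in
/-- Smoothed densities are uniformly close when the characteristic functions are close on a large
interval. -/
theorem abs_gaussianSmoothing_sub_le (v : NNReal) (hv : v ≠ 0) (μ ν : Measure ℝ)
    [IsProbabilityMeasure μ] [IsProbabilityMeasure ν] {ε T : ℝ} (hε : 0 ≤ ε) (hT : 0 < T)
    (h : ∀ t, |t| < T → ‖charFun μ t - charFun ν t‖ ≤ ε) (y : ℝ) :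
    |gaussianSmoothing v μ y - gaussianSmoothing v ν y| ≤
      (√(2 * Real.pi * v))⁻¹ * (ε + 2 * (v : ℝ)⁻¹ / T ^ 2) := by
  have hexp : ∀ t : ℝ, ‖Complex.exp (-(t * y * Complex.I))‖ = 1 := fun t => by
    have h := Complex.norm_exp_ofReal_mul_I (-(t * y))
    push_cast at h
    rwa [neg_mul] at h
  have hint : ∀ (ρ : Measure ℝ) [IsProbabilityMeasure ρ], Integrable
      (fun t : ℝ => Complex.exp (-(t * y * Complex.I)) * charFun ρ t) (gaussianReal 0 v⁻¹) := by
    intro ρ _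
    refine Integrable.of_bound (C := 1) (AEStronglyMeasurable.mul
      (Continuous.aestronglyMeasurable (by fun_prop))
      stronglyMeasurable_charFun.aestronglyMeasurable) (Filter.Eventually.of_forall fun t => ?_)
    rw [norm_mul, hexp, one_mul]
    exact norm_charFun_le_one t
  have hnorm : |gaussianSmoothing v μ y - gaussianSmoothing v ν y| =
      ‖(gaussianSmoothing v μ y : ℂ) - gaussianSmoothing v ν y‖ := by
    rw [← Complex.ofReal_sub, Complex.norm_real, Real.norm_eq_abs]
  rw [hnorm, ofReal_gaussianSmoothing v hv, ofReal_gaussianSmoothing v hv, ← mul_sub,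
    ← integral_sub (hint μ) (hint ν), norm_mul, Complex.norm_real, Real.norm_of_nonneg (by positivity)]
  gcongr
  rw [← NNReal.coe_inv]
  -- Two characteristic functions differ by at most 2 everywhere, which controls the tail `T ≤ |t|`.
  refine norm_integral_gaussianReal_le _ _ hε zero_le_two hT (fun t ht => ?_) (fun t => ?_)
  · rw [← mul_sub, norm_mul, hexp, one_mul]
    exact h t ht
  · rw [← mul_sub, norm_mul, hexp, one_mul]
    refine (norm_sub_le _ _).trans ?_
    linarith [norm_charFun_le_one (μ := μ) t, norm_charFun_le_one (μ := ν) t]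

-- Substitute `y = x + z`, then apply Fubini: the kernel is bounded and `f` is integrable.
open ProbabilityTheory in
theorem integral_integral_gaussianReal_eq (v : NNReal) (hv : v ≠ 0) (μ : Measure ℝ)
    [IsProbabilityMeasure μ] {f : ℝ → ℝ} (hf : Integrable f) :
    ∫ x, ∫ z, f (x + z) ∂(gaussianReal 0 v) ∂μ = ∫ y, gaussianSmoothing v μ y * f y := by
  have h : ∀ x : ℝ, ∫ z, f (x + z) ∂(gaussianReal 0 v) =
      ∫ y, gaussianPDFReal 0 v (y - x) * f y := fun x => by
    rw [integral_gaussianReal_eq_integral_smul hv,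
      ← integral_sub_right_eq_self (fun z => gaussianPDFReal 0 v z • f (x + z)) x]
    simp
  simp_rw [h]
  rw [integral_integral_swap]
  · simp_rw [integral_mul_const]
    rfl
  · have h1 : Integrable (fun p : ℝ × ℝ => f p.2) (μ.prod volume) := hf.comp_snd μ
    refine h1.bdd_mul (c := (√(2 * Real.pi * v))⁻¹) ?_ (Filter.Eventually.of_forall fun p => ?_)
    · exact ((measurable_gaussianPDFReal 0 v).comp
        (measurable_snd.sub measurable_fst)).aestronglyMeasurable
    · rw [Real.norm_of_nonneg (gaussianPDFReal_nonneg _ _ _)]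
      exact gaussianPDFReal_zero_le v _

open ProbabilityTheory in
theorem integrable_gaussianSmoothing_mul (v : NNReal) (μ : Measure ℝ)
    [IsProbabilityMeasure μ] {f : ℝ → ℝ} (hf : Integrable f) :
    Integrable fun y => gaussianSmoothing v μ y * f y := by
  refine hf.bdd_mul (c := (√(2 * Real.pi * v))⁻¹) ?_ (Filter.Eventually.of_forall fun y => ?_)
  · refine (StronglyMeasurable.integral_prod_right
      (f := fun y x => gaussianPDFReal 0 v (y - x)) ?_).aestronglyMeasurable
    exact ((measurable_gaussianPDFReal 0 v).comp
      (measurable_fst.sub measurable_snd)).stronglyMeasurable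
  · refine (norm_integral_le_of_norm_le_const (C := (√(2 * Real.pi * v))⁻¹)
      (Filter.Eventually.of_forall fun x => ?_)).trans_eq (by simp)
    rw [Real.norm_of_nonneg (gaussianPDFReal_nonneg _ _ _)]
    exact gaussianPDFReal_zero_le v _

open ProbabilityTheory in
/-- The error made by smoothing a bounded continuous function by a centred Gaussian. -/
theorem abs_integral_sub_integral_gaussianReal_le (v : NNReal) (μ : Measure ℝ)
    [IsProbabilityMeasure μ] {f : ℝ → ℝ} (hf : Continuous f) {ε δ M : ℝ} (hε : 0 ≤ ε) (hδ : 0 < δ)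
    (hM : ∀ x, |f x| ≤ M) (hmod : ∀ x y, |x - y| < δ → |f x - f y| ≤ ε) :
    |(∫ x, f x ∂μ) - ∫ x, ∫ z, f (x + z) ∂(gaussianReal 0 v) ∂μ| ≤ ε + 2 * M * v / δ ^ 2 := by
  have hM0 : 0 ≤ M := (abs_nonneg _).trans (hM 0)
  have h1 : Integrable f μ :=
    Integrable.of_bound hf.aestronglyMeasurable M (Filter.Eventually.of_forall hM)
  have h2 : ∀ x, Integrable (fun z => f (x + z)) (gaussianReal 0 v) := fun x =>
    Integrable.of_bound (hf.comp (by fun_prop)).aestronglyMeasurable M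
      (Filter.Eventually.of_forall fun z => hM _)
  have h3 : Integrable (fun x => ∫ z, f (x + z) ∂(gaussianReal 0 v)) μ := by
    refine Integrable.of_bound ?_ M (Filter.Eventually.of_forall fun x => ?_)
    · refine (StronglyMeasurable.integral_prod_right (f := fun x z => f (x + z))
        ?_).aestronglyMeasurable
      exact (hf.comp (by fun_prop : Continuous fun p : ℝ × ℝ => p.1 + p.2)).stronglyMeasurable
    · exact (norm_integral_le_of_norm_le_const
        (Filter.Eventually.of_forall fun z => hM _)).trans_eq (by simp)
  rw [← integral_sub h1 h3, ← Real.norm_eq_abs]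
  refine (norm_integral_le_of_norm_le_const (C := ε + 2 * M * v / δ ^ 2)
    (Filter.Eventually.of_forall fun x => ?_)).trans_eq (by simp)
  have h4 : f x - ∫ z, f (x + z) ∂(gaussianReal 0 v) =
      ∫ z, (f x - f (x + z)) ∂(gaussianReal 0 v) := by
    rw [integral_sub (integrable_const _) (h2 x)]
    simp
  rw [h4]
  refine norm_integral_gaussianReal_le _ _ hε (by positivity) hδ (fun z hz => ?_) (fun z => ?_)
  · exact hmod _ _ (by simpa using hz)
  · refine (norm_sub_le _ _).trans ?_
    rw [Real.norm_eq_abs, Real.norm_eq_abs]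
    linarith [hM x, hM (x + z)]

/-- Quantitative form of Glivenko's theorem for a single test function. -/
theorem abs_integral_sub_integral_le (v : NNReal) (hv : v ≠ 0) (μ ν : Measure ℝ)
    [IsProbabilityMeasure μ] [IsProbabilityMeasure ν] {f : ℝ → ℝ} (hf : Continuous f)
    {ε δ M L η T : ℝ} (hε : 0 ≤ ε) (hδ : 0 < δ) (hL : 0 ≤ L) (hη : 0 ≤ η) (hT : 0 < T)
    (hM : ∀ x, |f x| ≤ M) (hmod : ∀ x y, |x - y| < δ → |f x - f y| ≤ ε)
    (hsupp : ∀ x, L ≤ |x| → f x = 0)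
    (hchar : ∀ t, |t| < T → ‖charFun μ t - charFun ν t‖ ≤ η) :
    |(∫ x, f x ∂μ) - ∫ x, f x ∂ν| ≤ 2 * (ε + 2 * M * v / δ ^ 2) +
      2 * L * M * ((√(2 * Real.pi * v))⁻¹ * (η + 2 * (v : ℝ)⁻¹ / T ^ 2)) := by
  have hzero : ∀ x, x ∉ Set.Icc (-L) L → f x = 0 := fun x hx =>
    hsupp x (le_of_not_ge fun h => hx (abs_le.1 h))
  have hfi : Integrable f := hf.integrable_of_hasCompactSupport
    (HasCompactSupport.intro isCompact_Icc hzero)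
  have h1 := abs_integral_sub_integral_gaussianReal_le v μ hf hε hδ hM hmod
  have h2 := abs_integral_sub_integral_gaussianReal_le v ν hf hε hδ hM hmod
  rw [integral_integral_gaussianReal_eq v hv _ hfi] at h1 h2
  set K := (√(2 * Real.pi * v))⁻¹ * (η + 2 * (v : ℝ)⁻¹ / T ^ 2) with hK
  have hK0 : 0 ≤ K := by positivity
  have h3 : |(∫ y, gaussianSmoothing v μ y * f y) - ∫ y, gaussianSmoothing v ν y * f y| ≤
      2 * L * M * K := by
    rw [← integral_sub (integrable_gaussianSmoothing_mul v μ hfi)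
      (integrable_gaussianSmoothing_mul v ν hfi), ← setIntegral_eq_integral_of_forall_compl_eq_zero
      (s := Set.Icc (-L) L) (fun x hx => by rw [hzero x hx]; simp), ← Real.norm_eq_abs]
    refine (norm_setIntegral_le_of_norm_le_const (C := K * M) (by simp) fun y _ => ?_).trans_eq ?_
    · rw [← sub_mul, norm_mul]
      exact mul_le_mul (abs_gaussianSmoothing_sub_le v hv μ ν hη hT hchar y) (hM y)
        (norm_nonneg _) hK0
    · rw [Real.volume_real_Icc_of_le (by linarith)]
      ring
  rw [abs_le] at *
  constructor <;> linarith [h1.1, h1.2, h2.1, h2.2, h3.1, h3.2]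

/-! ### Global modulus and sup bound from the support -/

/-- A modulus of continuity on `[-(L + 1), L + 1]` of a function vanishing outside `(-L, L)` is a
global one. -/
theorem abs_sub_lt_of_forall_abs_le {f : ℝ → ℝ} {L δ ε : ℝ} (hδ : δ ≤ 1) (hε : 0 < ε)
    (hsupp : ∀ x, L ≤ |x| → f x = 0)
    (hmod : ∀ x y, |x| ≤ L + 1 → |y| ≤ L + 1 → |x - y| < δ → |f x - f y| < ε) (x y : ℝ)
    (hxy : |x - y| < δ) : |f x - f y| < ε := by
  have h1 := abs_sub_abs_le_abs_sub x y
  have h2 := abs_sub_abs_le_abs_sub y x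
  rw [abs_sub_comm y x] at h2
  -- If one point leaves `[-(L + 1), L + 1]`, then `δ ≤ 1` keeps the other outside `(-L, L)`, so `f`
  -- vanishes at both.
  by_cases hx : |x| ≤ L + 1
  · by_cases hy : |y| ≤ L + 1
    · exact hmod x y hx hy hxy
    · rw [hsupp x (by linarith), hsupp y (by linarith)]
      simpa
  · rw [hsupp x (by linarith), hsupp y (by linarith)]
    simpa

/-- A function vanishing outside `(-L, L)` whose increments over distance `h` are at most `1` is
bounded by the number of steps of length `h` needed to leave the support. -/
theorem abs_le_of_increment_le_one {f : ℝ → ℝ} {L h : ℝ} (hh : 0 ≤ h)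
    (hsupp : ∀ x, L ≤ |x| → f x = 0) (hmod : ∀ x y, |x - y| ≤ h → |f x - f y| ≤ 1) (i : ℕ) :
    ∀ x, L ≤ |x| + i * h → |f x| ≤ i := by
  induction i with
  | zero =>
    intro x hx
    rw [hsupp x (by simpa using hx)]
    simp
  | succ i ih =>
    intro x hx
    -- Step outwards, away from the origin.
    obtain ⟨y, hy, hxy⟩ : ∃ y, |y| = |x| + h ∧ |x - y| = h := by
      rcases le_total 0 x with hx0 | hx0
      · exact ⟨x + h, by rw [abs_of_nonneg hx0, abs_of_nonneg (by linarith)],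
          by simp [abs_of_nonneg hh]⟩
      · exact ⟨x - h, by rw [abs_of_nonpos hx0, abs_of_nonpos (by linarith)]; ring,
          by simp [abs_of_nonneg hh]⟩
    push_cast at hx ⊢
    have h1 := ih y (by rw [hy]; linarith)
    have h2 := hmod x y hxy.le
    have h3 := abs_sub_abs_le_abs_sub (f x) (f y)
    linarith

/-! ### Recursive choice of parameters -/

theorem Computable.two_pow {α : Type*} [Primcodable α] {f : α → ℕ} (hf : Computable f) :
    Computable fun a => 2 ^ f a := by
  refine (Computable.nat_rec (h := fun _ p => 2 * p.2) hf (Computable.const 1) ?_).of_eq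
    fun a => ?_
  · exact (Primrec.nat_mul.to_comp.comp (Computable.const 2)
      (Computable.snd.comp Computable.snd)).to₂
  · induction f a with
    | zero => rfl
    | succ n ih => simp only [ih, pow_succ]; ring

/-- The numerical estimate behind the choice of the parameters: variance `4 ^ (-s)` of the smoothing
kernel, accuracy `2 ^ (-j)` of the characteristic functions on `[-2 ^ (j + s), 2 ^ (j + s)]`. -/
theorem parameter_estimate (k L M a s j : ℕ) (hs : s = M + a + k + 4) (hj : j = L + M + s + k + 5) :
    2 * (((2 : ℝ) ^ (k + 3))⁻¹ +
        2 * M * (((2 : NNReal) ^ (2 * s))⁻¹ : NNReal) / (((2 : ℝ) ^ a)⁻¹) ^ 2) +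
      2 * L * M * ((√(2 * Real.pi * (((2 : NNReal) ^ (2 * s))⁻¹ : NNReal)))⁻¹ *
        (((2 : ℝ) ^ j)⁻¹ + 2 * ((((2 : NNReal) ^ (2 * s))⁻¹ : NNReal) : ℝ)⁻¹ /
          ((2 : ℝ) ^ (j + s)) ^ 2)) < ((2 : ℝ) ^ k)⁻¹ := by
  -- Crude bounds `n ≤ 2 ^ n` reduce the main estimates to comparing exponents of 2.
  have hM : (M : ℝ) ≤ 2 ^ M := by exact_mod_cast M.lt_two_pow_self.le
  have hL : (L : ℝ) ≤ 2 ^ L := by exact_mod_cast L.lt_two_pow_self.le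
  have hsqrt : (√(2 * Real.pi * (((2 : NNReal) ^ (2 * s))⁻¹ : NNReal)))⁻¹ ≤ 2 ^ s := by
    rw [inv_le_comm₀ (by positivity) (by positivity)]
    apply Real.le_sqrt_of_sq_le
    push_cast
    rw [inv_pow, ← pow_mul, mul_comm s 2]
    exact le_mul_of_one_le_left (by positivity) (by linarith [Real.pi_gt_three])
  have h1 : 2 * M * (((2 : NNReal) ^ (2 * s))⁻¹ : NNReal) / (((2 : ℝ) ^ a)⁻¹) ^ 2 ≤
      ((2 : ℝ) ^ (k + 3))⁻¹ := by
    push_cast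
    calc 2 * M * ((2 : ℝ) ^ (2 * s))⁻¹ / (((2 : ℝ) ^ a)⁻¹) ^ 2
        ≤ 2 * 2 ^ M * ((2 : ℝ) ^ (2 * s))⁻¹ / (((2 : ℝ) ^ a)⁻¹) ^ 2 := by gcongr
      _ = 2 ^ (M + 1 + 2 * a) / (2 : ℝ) ^ (2 * s) := by
          field_simp
          ring
      _ ≤ ((2 : ℝ) ^ (k + 3))⁻¹ := by
          rw [div_le_iff₀ (by positivity), inv_mul_eq_div, le_div_iff₀ (by positivity), ← pow_add]
          exact pow_le_pow_right₀ one_le_two (by omega)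
  have h2 : ((2 : ℝ) ^ j)⁻¹ + 2 * ((((2 : NNReal) ^ (2 * s))⁻¹ : NNReal) : ℝ)⁻¹ /
      ((2 : ℝ) ^ (j + s)) ^ 2 ≤ 3 * ((2 : ℝ) ^ j)⁻¹ := by
    push_cast
    have : 2 * (((2 : ℝ) ^ (2 * s))⁻¹)⁻¹ / ((2 : ℝ) ^ (j + s)) ^ 2 =
        2 * (((2 : ℝ) ^ j)⁻¹ * ((2 : ℝ) ^ j)⁻¹) := by
      field_simp
      ring
    rw [this]
    have h3 : ((2 : ℝ) ^ j)⁻¹ ≤ 1 := inv_le_one_of_one_le₀ (one_le_pow₀ one_le_two)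
    have h4 : 0 < ((2 : ℝ) ^ j)⁻¹ := by positivity
    nlinarith
  have h3 : 2 * L * M * ((√(2 * Real.pi * (((2 : NNReal) ^ (2 * s))⁻¹ : NNReal)))⁻¹ *
        (((2 : ℝ) ^ j)⁻¹ + 2 * ((((2 : NNReal) ^ (2 * s))⁻¹ : NNReal) : ℝ)⁻¹ /
          ((2 : ℝ) ^ (j + s)) ^ 2)) ≤ 6 * ((2 : ℝ) ^ (k + 5))⁻¹ := by
    calc _ ≤ 2 * 2 ^ L * 2 ^ M * ((2 : ℝ) ^ s * (3 * ((2 : ℝ) ^ j)⁻¹)) := by gcongr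
      _ = 6 * ((2 : ℝ) ^ (k + 5))⁻¹ := by
          rw [hj]
          simp only [pow_add]
          field_simp
          ring
  have h4 : 0 < ((2 : ℝ) ^ k)⁻¹ := by positivity
  have h5 : ((2 : ℝ) ^ (k + 3))⁻¹ = ((2 : ℝ) ^ k)⁻¹ / 8 := by rw [pow_add]; field_simp; norm_num
  have h6 : ((2 : ℝ) ^ (k + 5))⁻¹ = ((2 : ℝ) ^ k)⁻¹ / 32 := by rw [pow_add]; field_simp; norm_num
  -- In units of `2 ^ (-k)` the total is at most `2 * (1/8 + 1/8) + 6/32 = 11/16`.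
  rw [h5] at h1 ⊢
  rw [h6] at h3
  linarith

theorem theorem4p2 (μ : ℕ → Measure ℝ) (ν : Measure ℝ)
    [∀ m, IsProbabilityMeasure (μ m)] [IsProbabilityMeasure ν]
    (φ : ℕ → ℝ → ℂ) (ψ : ℝ → ℂ)
    (hφ : ∀ m, φ m = charFun (μ m)) (hψ : ψ = charFun ν)
    (hcomp : IsComputableComplexFun φ)
    (hconv : ConvergesEffectively φ ψ) :
    MeasuresConvergeEffectively μ ν := by
  rintro f ⟨-, α, hα, hαf⟩ ⟨L, hL, hLf⟩
  obtain ⟨β, hβ, hβφ⟩ := hconv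
  have hadd {g h : ℕ × ℕ → ℕ} (hg : Computable g) (hh : Computable h) :
      Computable fun p => g p + h p := Primrec.nat_add.to_comp.comp hg hh
  let a : ℕ × ℕ → ℕ := fun p => α (p.1, L p.1 + 1, p.2 + 3)
  let b : ℕ × ℕ → ℕ := fun p => α (p.1, L p.1 + 1, 0)
  -- Number of steps of length `2 ^ (-(b + 1))` from the origin to `L`. The extra 1 puts the step
  -- strictly below the modulus `2 ^ (-b)` for increments less than 1.
  let M : ℕ × ℕ → ℕ := fun p => L p.1 * 2 ^ (b p + 1)
  let s : ℕ × ℕ → ℕ := fun p => M p + a p + p.2 + 4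
  let j : ℕ × ℕ → ℕ := fun p => L p.1 + M p + s p + p.2 + 5
  have hc (c : ℕ) : Computable fun _ : ℕ × ℕ => c := Computable.const c
  have hL' : Computable fun p : ℕ × ℕ => L p.1 := hL.comp Computable.fst
  have ha : Computable a := hα.comp
    (Computable.fst.pair ((hadd hL' (hc 1)).pair (hadd Computable.snd (hc 3))))
  have hb : Computable b := hα.comp (Computable.fst.pair ((hadd hL' (hc 1)).pair (hc 0)))
  have hM : Computable M := Primrec.nat_mul.to_comp.comp hL' (hadd hb (hc 1)).two_pow
  have hs : Computable s := hadd (hadd (hadd hM ha) Computable.snd) (hc 4)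
  have hj : Computable j := hadd (hadd (hadd (hadd hL' hM) hs) Computable.snd) (hc 5)
  refine ⟨fun p => β (2 ^ (j p + s p), j p), hβ.comp ((hadd hj hs).two_pow.pair hj), ?_⟩
  intro n k m hm
  have hmod : ∀ i x y, |x - y| < ((2 : ℝ) ^ α (n, L n + 1, i))⁻¹ →
      |f n x - f n y| < ((2 : ℝ) ^ i)⁻¹ := fun i =>
    abs_sub_lt_of_forall_abs_le (inv_le_one_of_one_le₀ (one_le_pow₀ one_le_two)) (by positivity)
      (hLf n) fun x y hx hy hxy => hαf n (L n + 1) i x y (by push_cast; exact hx)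
        (by push_cast; exact hy) hxy
  have hcont : Continuous (f n) := by
    rw [Metric.continuous_iff]
    intro x ε hε
    obtain ⟨i, hi⟩ := exists_pow_lt_of_lt_one hε (by norm_num : (2 : ℝ)⁻¹ < 1)
    refine ⟨((2 : ℝ) ^ α (n, L n + 1, i))⁻¹, by positivity, fun y hy => ?_⟩
    rw [Real.dist_eq] at hy ⊢
    rw [inv_pow] at hi
    exact (hmod i y x hy).trans hi
  have hbound : ∀ x, |f n x| ≤ M (n, k) := fun x => by
    have hb0 : (0 : ℝ) < (2 ^ (b (n, k) + 1))⁻¹ := by positivity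
    refine abs_le_of_increment_le_one hb0.le (hLf n) (fun x y hxy => ?_) (M (n, k)) x ?_
    · refine ((hmod 0 x y (hxy.trans_lt ?_)).trans_eq (by simp)).le
      exact inv_strictAnti₀ (by positivity) (pow_lt_pow_right₀ one_lt_two (Nat.lt_succ_self _))
    · have : (M (n, k) : ℝ) * (2 ^ (b (n, k) + 1))⁻¹ = L n := by
        simp only [M]
        push_cast
        field_simp
      rw [this]
      linarith [abs_nonneg x]
  refine lt_of_le_of_lt (abs_integral_sub_integral_le (((2 : NNReal) ^ (2 * s (n, k)))⁻¹)
    (by positivity) (μ m) ν hcont (ε := (2 ^ (k + 3))⁻¹) (δ := (2 ^ a (n, k))⁻¹) (M := M (n, k))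
    (L := L n) (η := (2 ^ j (n, k))⁻¹) (T := 2 ^ (j (n, k) + s (n, k))) (by positivity)
    (by positivity) (by positivity) (by positivity) (by positivity) hbound
    (fun x y hxy => (hmod (k + 3) x y hxy).le) (hLf n) fun t ht => ?_)
    (parameter_estimate k (L n) (M (n, k)) (a (n, k)) (s (n, k)) (j (n, k)) rfl rfl)
  rw [← hφ, ← hψ]
  exact (hβφ _ _ m hm t (by push_cast; exact ht.le)).le
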